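/- Let $A=\{0,1,\dots,d\}$ with $d\ge 1$, let $X\subset\mathbb R$ be a compact connected set and let $f_a:X\to\operatorname{Int}X$ $(a\in A)$ be contractions (Lipschitz constants $<1$) with pairwise disjoint images such that, for some $\epsilon>0$ and some open interval $Y\supset X$, every $f_a$ extends to a $C^{1+\epsilon}$ map $Y\to Y$ (with $\epsilon$-Hölder derivative) which is a diffeomorphism onto its image. The letters are labelled so that $f_0(X)$ is the leftmost and $f_1(X)$ the rightmost of the sets $f_a(X)$. Write $f_\omega=f_{x_1}\circ\dots\circ f_{x_n}$ for $\omega=x_1\dots x_n\in A^n$, let $\mathcal L=\bigcap_{n}\bigcup_{\omega\in A^n}f_\omega(X)$ be the limit set, identify each $\xi\in\mathcal L$ with its unique code $(x_1x_2\dots)\in A^{\mathbb N}$, $\{\xi\}=\bigcap_n f_{x_1\dots x_n}(X)$, let $\sigma$ be the left shift, $S_ng=\sum_{k<n}g\circ\sigma^k$, and let $[\omega]\subset\mathcal L$ be the set of points whose code begins with $\omega$. Put $\phi(\xi)=\log|f_{x_1}'(\sigma\xi)|$ and $P(g)=\lim_{n\to\infty}\frac1n\log\sum_{\omega\in A^n}\exp(\sup_{[\omega]}S_ng)$.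 Let $\alpha>0$ and let $\psi:\mathcal L\to\mathbb R$ be Hölder continuous with $P(\psi)=0$ and $\alpha\phi<\psi<0$ on $\mathcal L$. Let $\nu_\psi$ be a Gibbs measure for $\psi$, i.e. a Borel probability measure with $\nu_\psi(\mathbb R\setminus\mathcal L)=0$ for which there is $C>0$ with $C^{-1}e^{S_n\psi(\xi)}\le\nu_\psi([\omega])\le Ce^{S_n\psi(\xi)}$ for all $n$, all $\omega\in A^n$ and all $\xi\in[\omega]$. Let $F_\psi(x)=\nu_\psi((-\infty,x])$. Let $\mathcal L^*$ be the set of non-endpoints, i.e. the points of $\mathcal L$ whose code is neither eventually constantly $0$ nor eventually constantly $1$. Say that $D^\alpha F_\psi$ exists at $\xi$ in the generalized sense if $$(D^\alpha F_\psi)(\xi):=\lim_{\eta\to\xi,\ \eta\in\mathbb R\setminus\{\xi\}}\frac{|F_\psi(\xi)-F_\psi(\eta)|}{|\xi-\eta|^\alpha}$$ exists as a finite number or equals $\infty$. Then: 1. If $\xi\in\mathcal L^*$ and $D^\alpha F_\psi$ exists at $\xi$ in the generalized sense, then $(D^\alpha F_\psi)(\xi)=\infty$. 2. There are plenty of points of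 $\mathcal L^*$ at which $D^\alpha F_\psi$ does not exist in the generalized sense: every open set $U\subset\mathbb R$ that meets $\mathcal L$ contains uncountably many of them. -/

import Mathlib

open Set Filter Topology MeasureTheory
open scoped NNReal

/-- A conformal iterated function system on `ℝ` with alphabet `A = {0, 1, …, d}`, `d ≥ 1`, satisfying
the strong separation condition and the Hölder condition. Only the values of the maps `f a` on the
compact interval `X` are meaningful. -/
structure ConformalIFS (d : ℕ) where
  X : Set ℝ
  f : Fin (d + 1) → ℝ → ℝ
  one_le_d : 1 ≤ d
  isCompact_X : IsCompact X
  isConnected_X : IsConnected X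
  /-- every `f a` is a contraction of `X` … -/
  contracting : ∀ a, ∃ c : ℝ≥0, c < 1 ∧ LipschitzOnWith c (f a) X
  /-- … into the interior of `X` -/
  mapsTo_interior : ∀ a, MapsTo (f a) X (interior X)
  /-- the first level sets are pairwise disjoint -/
  separated : ∀ a b, a ≠ b → Disjoint (f a '' X) (f b '' X)
  /-- Hölder condition: on some open interval `Y ⊇ X` and for some `ε > 0`, every `f a` has a
  `C^{1+ε}` continuation `g` which maps `Y` diffeomorphically onto a subset of `Y`. -/
  holder : ∃ (ε : ℝ≥0) (Y : Set ℝ), 0 < ε ∧ IsOpen Y ∧ Y.OrdConnected ∧ X ⊆ Y ∧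
    ∀ a, ∃ g : ℝ → ℝ, EqOn g (f a) X ∧ DifferentiableOn ℝ g Y ∧
      (∃ C : ℝ≥0, HolderOnWith C ε (deriv g) Y) ∧ MapsTo g Y Y ∧ InjOn g Y ∧
      ∀ y ∈ Y, deriv g y ≠ 0
  /-- `f 0 '' X` is the leftmost set of the first level … -/
  zero_left : ∀ a, a ≠ 0 → ∀ x ∈ f 0 '' X, ∀ y ∈ f a '' X, x < y
  /-- … and `f 1 '' X` is the rightmost one -/
  one_right : ∀ a, a ≠ 1 → ∀ x ∈ f 1 '' X, ∀ y ∈ f a '' X, y < x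

namespace ConformalIFS

variable {d : ℕ}

/-- `f_ω = f_{x₁} ∘ ⋯ ∘ f_{xₙ}` for the word `ω = x₁ ⋯ xₙ`. -/
def wordMap (F : ConformalIFS d) (w : List (Fin (d + 1))) (y : ℝ) : ℝ :=
  w.foldr F.f y

/-- The limit set `⋂ₙ ⋃_{ω ∈ Aⁿ} f_ω(X)`. -/
def limitSet (F : ConformalIFS d) : Set ℝ :=
  ⋂ n : ℕ, ⋃ w : Fin n → Fin (d + 1), F.wordMap (List.ofFn w) '' F.X

/-- `⋂ₙ f_{x₁ ⋯ xₙ}(X)`, a single point, for an infinite word `x`. -/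
def codeSet (F : ConformalIFS d) (x : ℕ → Fin (d + 1)) : Set ℝ :=
  ⋂ n : ℕ, F.wordMap (List.ofFn fun i : Fin n => x i) '' F.X

theorem continuousOn_mapsTo_wordMap (F : ConformalIFS d) (w : List (Fin (d + 1))) :
    ContinuousOn (F.wordMap w) F.X ∧ MapsTo (F.wordMap w) F.X F.X := by
  induction w with
  | nil => exact ⟨continuousOn_id, mapsTo_id _⟩
  | cons a w ih =>
    obtain ⟨c, -, hc⟩ := F.contracting a
    exact ⟨hc.continuousOn.comp ih.1 ih.2,
      ((F.mapsTo_interior a).mono_right interior_subset).comp ih.2⟩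

theorem codeSet_nonempty (F : ConformalIFS d) (x : ℕ → Fin (d + 1)) : (F.codeSet x).Nonempty := by
  have hK : ∀ n : ℕ, IsCompact (F.wordMap (List.ofFn fun i : Fin n => x i) '' F.X) := fun n =>
    F.isCompact_X.image_of_continuousOn (F.continuousOn_mapsTo_wordMap _).1
  refine IsCompact.nonempty_iInter_of_sequence_nonempty_isCompact_isClosed _ (fun n => ?_)
    (fun n => F.isConnected_X.nonempty.image _) (hK 0) (fun n => (hK n).isClosed)
  rintro _ ⟨y, hy, rfl⟩
  refine ⟨F.f (x n) y, interior_subset (F.mapsTo_interior _ hy), ?_⟩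
  rw [List.ofFn_succ']
  simp [wordMap]

theorem codeSet_subset_limitSet (F : ConformalIFS d) (x : ℕ → Fin (d + 1)) :
    F.codeSet x ⊆ F.limitSet :=
  iInter_mono fun n => subset_iUnion
    (fun w : Fin n → Fin (d + 1) => F.wordMap (List.ofFn w) '' F.X) (fun i : Fin n => x i)

/-- The coding map `Φ : A^ℕ → 𝓛`, `Φ x` being the unique point of `⋂ₙ f_{x₁ ⋯ xₙ}(X)`. -/
noncomputable def coding (F : ConformalIFS d) (x : ℕ → Fin (d + 1)) : F.limitSet :=
  ⟨(F.codeSet_nonempty x).some, F.codeSet_subset_limitSet x (F.codeSet_nonempty x).some_mem⟩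

/-- The left shift `σ` on infinite words. -/
def shift (x : ℕ → Fin (d + 1)) : ℕ → Fin (d + 1) := fun n => x (n + 1)

/-- The infinite words that begin with the finite word `w`. -/
def cylinder {n : ℕ} (w : Fin n → Fin (d + 1)) : Set (ℕ → Fin (d + 1)) :=
  {x | ∀ i : Fin n, x i = w i}

/-- The geometric potential `log |f_{x₁}'(σ ξ)|` at the point `ξ` with code `x = x₁ x₂ …`. -/
noncomputable def geometricPotential (F : ConformalIFS d) (x : ℕ → Fin (d + 1)) : ℝ :=
  Real.log |deriv (F.f (x 0)) (F.coding (shift x))|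

/-- The Birkhoff sum `Sₙ g = ∑_{k < n} g ∘ σᵏ` of a function `g` on the limit set, as a function of
the code. -/
noncomputable def sumAlong (F : ConformalIFS d) (g : F.limitSet → ℝ) (n : ℕ)
    (x : ℕ → Fin (d + 1)) : ℝ :=
  birkhoffSum shift (fun y => g (F.coding y)) n x

/-- `P(g) = p`: the limit defining the topological pressure of `g` exists and equals `p`. -/
def HasPressure (F : ConformalIFS d) (g : F.limitSet → ℝ) (p : ℝ) : Prop :=
  Tendsto (fun n : ℕ => (1 / (n : ℝ)) * Real.log (∑ w : Fin n → Fin (d + 1),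
    Real.exp (sSup (F.sumAlong g n '' cylinder w)))) atTop (𝓝 p)

/-- `ν` is a Gibbs measure for `ψ`: a Borel probability measure carried by the limit set with
`ν [ω] ≍ exp (Sₙ ψ(ξ))`, uniformly in `n`, `ω ∈ Aⁿ` and `ξ ∈ [ω]`. -/
def IsGibbs (F : ConformalIFS d) (ψ : F.limitSet → ℝ) (ν : Measure ℝ) : Prop :=
  IsProbabilityMeasure ν ∧ ν F.limitSetᶜ = 0 ∧
    ∃ C : ℝ, 0 < C ∧ ∀ (n : ℕ) (w : Fin n → Fin (d + 1)), ∀ x ∈ cylinder w,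
      C⁻¹ * Real.exp (F.sumAlong ψ n x) ≤ ν.real ((fun y => (F.coding y : ℝ)) '' cylinder w) ∧
      ν.real ((fun y => (F.coding y : ℝ)) '' cylinder w) ≤ C * Real.exp (F.sumAlong ψ n x)

/-- The set `𝓔` of end points: the points of the limit set whose code is eventually constantly `0`
or eventually constantly `1`. -/
def endPoints (F : ConformalIFS d) : Set ℝ :=
  {ξ | ∃ x : ℕ → Fin (d + 1), ξ = F.coding x ∧
    ∃ i : Fin (d + 1), (i = 0 ∨ i = 1) ∧ ∃ n : ℕ, ∀ k, n ≤ k → x k = i}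

end ConformalIFS

/-- The distribution function `x ↦ ν (-∞, x]`. -/
noncomputable def distFun (ν : Measure ℝ) (x : ℝ) : ℝ := ν.real (Iic x)

/-- `(D^α G)(ξ) = l` in the generalized sense: the limit of `|G ξ - G η| / |ξ - η| ^ α` as `η → ξ`,
`η ≠ ξ`, exists in the extended reals and equals `l`; so `l` may be `⊤`, i.e. `∞`. -/
def HasHolderDeriv (α : ℝ) (G : ℝ → ℝ) (ξ : ℝ) (l : EReal) : Prop :=
  Tendsto (fun η : ℝ => ((|G ξ - G η| / |ξ - η| ^ α : ℝ) : EReal)) (𝓝[≠] ξ) (𝓝 l)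

/-! Since `ψ - αφ` is continuous and positive on a compact space, it is at least some `c > 0`. Hence
the mass of `f_ω(X)`, of order `exp (Sₙ ψ)`, exceeds its length to the power `α` by an exponentially
growing factor. One end of `f_ω(X)` sees at least half of that mass from `ξ`, so the quotients are
unbounded at every point of the limit set, and a limit can only be `∞`
(`IsGibbs.exists_le_quotient`). Sub-exponential distortion suffices, as its error is absorbed by
`c`.

Conversely, the distribution function is constant across gaps, so the quotient vanishes for suitable
pairs of points near any point of the limit set. By Baire, a generic `ξ` has quotients `< 1` along
some `η → ξ`, which excludes `∞` (`IsGibbs.residual_frequently_quotient_lt`). The limit set has no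
isolated points, so generic points avoid any given countable set, in particular the end points. -/

namespace ConformalIFS

variable {d : ℕ}

/-! ### Contraction and the coding map. -/

theorem exists_lipschitzOnWith_wordMap (F : ConformalIFS d) :
    ∃ c : ℝ≥0, c < 1 ∧ ∀ w, LipschitzOnWith (c ^ w.length) (F.wordMap w) F.X := by
  choose c hc hf using F.contracting
  refine ⟨Finset.univ.sup c, (Finset.sup_lt_iff one_pos).2 fun a _ => hc a, fun w => ?_⟩
  induction w with
  | nil => exact (pow_zero (Finset.univ.sup c)).symm ▸ LipschitzWith.id.lipschitzOnWith
  | cons a w ih =>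
    rw [List.length_cons, pow_succ']
    exact ((hf a).weaken (Finset.le_sup (Finset.mem_univ a))).comp ih
      (F.continuousOn_mapsTo_wordMap w).2

/-- The images of `X` under words of length `n` shrink uniformly as `n → ∞`. -/
theorem exists_abs_wordMap_sub_lt (F : ConformalIFS d) {δ : ℝ} (hδ : 0 < δ) :
    ∃ N, ∀ w : List (Fin (d + 1)), N ≤ w.length →
      ∀ u ∈ F.wordMap w '' F.X, ∀ v ∈ F.wordMap w '' F.X, |u - v| < δ := by
  obtain ⟨c, hc, hw⟩ := F.exists_lipschitzOnWith_wordMap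
  have ht : Tendsto (fun n : ℕ => (c : ℝ) ^ n * Metric.diam F.X) atTop (𝓝 0) := by
    simpa using (tendsto_pow_atTop_nhds_zero_of_lt_one c.2 (by exact_mod_cast hc)).mul_const
      (Metric.diam F.X)
  obtain ⟨N, hN⟩ := eventually_atTop.1 (ht.eventually (gt_mem_nhds hδ))
  refine ⟨N, ?_⟩
  rintro w hwN _ ⟨u, hu, rfl⟩ _ ⟨v, hv, rfl⟩
  refine lt_of_le_of_lt ?_ (hN w.length hwN)
  rw [← Real.dist_eq]
  refine ((hw w).dist_le_mul u hu v hv).trans ?_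
  push_cast
  gcongr
  exact Metric.dist_le_diam_of_mem F.isCompact_X.isBounded hu hv

theorem coding_mem_image (F : ConformalIFS d) (x : ℕ → Fin (d + 1)) (n : ℕ) :
    (F.coding x : ℝ) ∈ F.wordMap (List.ofFn fun i : Fin n => x i) '' F.X :=
  mem_iInter.1 (F.codeSet_nonempty x).some_mem n

theorem wordMap_image_subset (F : ConformalIFS d) (w : List (Fin (d + 1))) :
    F.wordMap w '' F.X ⊆ F.X :=
  (F.continuousOn_mapsTo_wordMap w).2.image_subset

theorem isCompact_wordMap_image (F : ConformalIFS d) (w : List (Fin (d + 1))) :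
    IsCompact (F.wordMap w '' F.X) :=
  F.isCompact_X.image_of_continuousOn (F.continuousOn_mapsTo_wordMap w).1

theorem isConnected_wordMap_image (F : ConformalIFS d) (w : List (Fin (d + 1))) :
    IsConnected (F.wordMap w '' F.X) :=
  F.isConnected_X.image _ (F.continuousOn_mapsTo_wordMap w).1

theorem coding_mem_interior (F : ConformalIFS d) (x : ℕ → Fin (d + 1)) :
    (F.coding x : ℝ) ∈ interior F.X := by
  obtain ⟨u, hu, h⟩ := F.coding_mem_image x 1
  rw [← h]
  simpa [wordMap] using F.mapsTo_interior (x 0) hu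

theorem eventually_eqOn_prefix (x : ℕ → Fin (d + 1)) (n : ℕ) :
    ∀ᶠ y in 𝓝 x, ∀ i : Fin n, y i = x i := by
  refine eventually_all.2 fun i => ?_
  exact ((continuous_apply (A := fun _ : ℕ => Fin (d + 1)) (i : ℕ)).tendsto x).eventually
    ((isOpen_discrete {x i}).mem_nhds rfl)

theorem continuous_coding (F : ConformalIFS d) : Continuous F.coding := by
  refine continuous_induced_rng.2 (continuous_iff_continuousAt.2 fun x => ?_)
  refine Metric.tendsto_nhds.2 fun δ hδ => ?_
  obtain ⟨N, hN⟩ := F.exists_abs_wordMap_sub_lt hδ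
  filter_upwards [eventually_eqOn_prefix x N] with y hy
  have h1 := F.coding_mem_image y N
  rw [show (fun i : Fin N => y i) = fun i : Fin N => x i from funext hy] at h1
  exact hN _ (by simp) _ h1 _ (F.coding_mem_image x N)

theorem isClosed_limitSet (F : ConformalIFS d) : IsClosed F.limitSet :=
  isClosed_iInter fun _ => isClosed_iUnion_of_finite fun _ =>
    (F.isCompact_wordMap_image _).isClosed

theorem limitSet_subset (F : ConformalIFS d) : F.limitSet ⊆ F.X := by
  intro ξ hξ
  obtain ⟨w, hw⟩ := mem_iUnion.1 (mem_iInter.1 hξ 0)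
  exact F.wordMap_image_subset _ hw

theorem isCompact_limitSet (F : ConformalIFS d) : IsCompact F.limitSet :=
  F.isCompact_X.of_isClosed_subset F.isClosed_limitSet F.limitSet_subset

theorem surjective_coding (F : ConformalIFS d) : Function.Surjective F.coding := by
  intro ξ
  have hcl : IsClosed (range F.coding) := (isCompact_range F.continuous_coding).isClosed
  suffices ξ ∈ closure (range F.coding) by rwa [hcl.closure_eq] at this
  refine Metric.mem_closure_iff.2 fun δ hδ => ?_
  obtain ⟨N, hN⟩ := F.exists_abs_wordMap_sub_lt hδ
  obtain ⟨w, hw⟩ := mem_iUnion.1 (mem_iInter.1 ξ.2 N)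
  -- The padding letter is irrelevant: only the first `N` letters locate the point.
  let x : ℕ → Fin (d + 1) := fun k => if h : k < N then w ⟨k, h⟩ else 0
  refine ⟨_, mem_range_self x, hN _ (by simp) _ hw _ ?_⟩
  have h1 := F.coding_mem_image x N
  rwa [show (fun i : Fin N => x i) = w from funext fun i => by simp [x]] at h1

/-! ### Derivatives, the geometric potential and distortion. -/

theorem continuous_shift : Continuous (shift : (ℕ → Fin (d + 1)) → ℕ → Fin (d + 1)) :=
  continuous_pi fun n => continuous_apply (n + 1)

/-- The regular continuations of the maps of the system to a neighbourhood of `X`. -/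
theorem exists_extension (F : ConformalIFS d) (a : Fin (d + 1)) :
    ∃ (Y : Set ℝ) (g : ℝ → ℝ), IsOpen Y ∧ F.X ⊆ Y ∧ EqOn g (F.f a) F.X ∧
      DifferentiableOn ℝ g Y ∧ ContinuousOn (deriv g) Y ∧ InjOn g Y ∧ ∀ y ∈ Y, deriv g y ≠ 0 := by
  obtain ⟨ε, Y, hε, hY, -, hXY, h⟩ := F.holder
  obtain ⟨g, hg, hd, ⟨C, hC⟩, -, hinj, hne⟩ := h a
  exact ⟨Y, g, hY, hXY, hg, hd, hC.continuousOn hε, hinj, hne⟩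

theorem injOn_f (F : ConformalIFS d) (a : Fin (d + 1)) : InjOn (F.f a) F.X := by
  obtain ⟨Y, g, -, hXY, hg, -, -, hinj, -⟩ := F.exists_extension a
  exact (hinj.mono hXY).congr hg

/-- `F.f a` is arbitrary off `X`, so its derivative is controlled only in the interior, where all
coded points lie. -/
theorem deriv_eqOn_interior (F : ConformalIFS d) {a : Fin (d + 1)} {g : ℝ → ℝ}
    (hg : EqOn g (F.f a) F.X) : EqOn (deriv (F.f a)) (deriv g) (interior F.X) := fun x hx =>
  EventuallyEq.deriv_eq <| by
    filter_upwards [mem_interior_iff_mem_nhds.1 hx] with y hy using (hg hy).symm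

theorem deriv_ne_zero (F : ConformalIFS d) (a : Fin (d + 1)) {x : ℝ} (hx : x ∈ interior F.X) :
    deriv (F.f a) x ≠ 0 := by
  obtain ⟨Y, g, -, hXY, hg, -, -, -, hne⟩ := F.exists_extension a
  rw [F.deriv_eqOn_interior hg hx]
  exact hne x (hXY (interior_subset hx))

theorem continuousOn_deriv (F : ConformalIFS d) (a : Fin (d + 1)) :
    ContinuousOn (deriv (F.f a)) (interior F.X) := by
  obtain ⟨Y, g, -, hXY, hg, -, hc, -, -⟩ := F.exists_extension a
  exact (hc.mono (interior_subset.trans hXY)).congr (F.deriv_eqOn_interior hg)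

theorem continuous_geometricPotential (F : ConformalIFS d) : Continuous F.geometricPotential := by
  refine continuous_iff_continuousAt.2 fun x => ?_
  have h : ContinuousAt (fun y => Real.log |deriv (F.f (x 0)) (F.coding (shift y))|) x := by
    have h1 : ContinuousAt (fun y => (F.coding (shift y) : ℝ)) x :=
      (continuous_subtype_val.comp (F.continuous_coding.comp continuous_shift)).continuousAt
    have h2 := (F.continuousOn_deriv (x 0)).continuousAt
      (isOpen_interior.mem_nhds (F.coding_mem_interior (shift x)))
    exact ((ContinuousAt.comp (f := fun y => (F.coding (shift y) : ℝ)) h2 h1).abs).log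
      (abs_ne_zero.2 (F.deriv_ne_zero _ (F.coding_mem_interior _)))
  refine h.congr ?_
  filter_upwards [eventually_eqOn_prefix x 1] with y hy
  rw [geometricPotential, show y 0 = x 0 from hy 0]

/-- One-step distortion bound: on a short interval the map `f a` expands distances at most by
`e ^ ε` times the derivative at any given point. -/
theorem exists_abs_f_sub_le (F : ConformalIFS d) {ε : ℝ} (hε : 0 < ε) (a : Fin (d + 1)) :
    ∃ δ > 0, ∀ K ⊆ F.X, Convex ℝ K → (∀ u ∈ K, ∀ v ∈ K, |u - v| < δ) →
      ∀ z ∈ K ∩ interior F.X, ∀ u ∈ K, ∀ v ∈ K,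
        |F.f a u - F.f a v| ≤ Real.exp (Real.log |deriv (F.f a) z| + ε) * |u - v| := by
  obtain ⟨Y, g, hY, hXY, hg, hd, hc, -, hne⟩ := F.exists_extension a
  have hlog : ContinuousOn (fun y => Real.log |deriv g y|) F.X :=
    ((hc.mono hXY).abs).log fun y hy => abs_ne_zero.2 (hne y (hXY hy))
  have hu := F.isCompact_X.uniformContinuousOn_of_continuous hlog
  obtain ⟨δ, hδ, h⟩ := Metric.uniformContinuousOn_iff.1 hu ε hε
  refine ⟨δ, hδ, fun K hKX hK hKδ z hz u hu v hv => ?_⟩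
  rw [← hg (hKX hu), ← hg (hKX hv), F.deriv_eqOn_interior hg hz.2, ← Real.norm_eq_abs,
    ← Real.norm_eq_abs (u - v)]
  refine hK.norm_image_sub_le_of_norm_deriv_le (fun y hy => (hd y (hXY (hKX hy))).differentiableAt
    (hY.mem_nhds (hXY (hKX hy)))) (fun y hy => ?_) hv hu
  have h1 := h y (hKX hy) z (hKX hz.1) (hKδ y hy z hz.1)
  rw [Real.dist_eq, abs_lt] at h1
  rw [Real.norm_eq_abs, ← Real.exp_log (abs_pos.2 (hne y (hXY (hKX hy))))]
  exact Real.exp_le_exp.2 (by linarith)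

/-- Sub-exponential distortion bound for the lengths of the intervals `f_ω(X)`. -/
theorem exists_abs_wordMap_sub_le (F : ConformalIFS d) {ε : ℝ} (hε : 0 < ε) :
    ∃ N, ∀ (m : ℕ) (x : ℕ → Fin (d + 1)),
      ∀ u ∈ F.wordMap (List.ofFn fun i : Fin (m + N) => x i) '' F.X,
      ∀ v ∈ F.wordMap (List.ofFn fun i : Fin (m + N) => x i) '' F.X,
        |u - v| ≤ Real.exp (birkhoffSum shift F.geometricPotential m x + m * ε) := by
  choose δ hδ h using F.exists_abs_f_sub_le hε
  obtain ⟨δ₀, hδ₀, hle⟩ : ∃ δ₀ > 0, ∀ a, δ₀ ≤ δ a :=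
    ⟨Finset.univ.inf' Finset.univ_nonempty δ, (Finset.lt_inf'_iff _).2 fun a _ => hδ a,
      fun a => Finset.inf'_le _ (Finset.mem_univ a)⟩
  -- The `N` spare letters keep every intermediate interval shorter than `δ₀`; the bound `1 = exp 0`
  -- starts the induction.
  obtain ⟨N, hN⟩ := F.exists_abs_wordMap_sub_lt (lt_min hδ₀ one_pos)
  refine ⟨N, fun m => ?_⟩
  induction m with
  | zero =>
    intro x u hu v hv
    simpa using ((hN _ (by simp) u hu v hv).trans_le (min_le_right _ _)).le
  | succ m ih =>
    have key : ∀ x : ℕ → Fin (d + 1),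
        F.wordMap (List.ofFn fun i : Fin (m + 1 + N) => x i) '' F.X =
        F.f (x 0) '' (F.wordMap (List.ofFn fun i : Fin (m + N) => shift x i) '' F.X) := by
      intro x
      rw [image_image, show m + 1 + N = (m + N) + 1 by omega, List.ofFn_succ]
      rfl
    intro x u hu v hv
    rw [key] at hu hv
    obtain ⟨u, hu, rfl⟩ := hu
    obtain ⟨v, hv, rfl⟩ := hv
    have h1 := h (x 0) _ (F.wordMap_image_subset _)
      (F.isConnected_wordMap_image (List.ofFn fun i : Fin (m + N) => shift x i)
        |>.isPreconnected.ordConnected.convex)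
      (fun u hu v hv => (hN _ (by simp) u hu v hv).trans_le
        ((min_le_left _ _).trans (hle (x 0))))
      _ ⟨F.coding_mem_image (shift x) (m + N), F.coding_mem_interior _⟩ u hu v hv
    refine h1.trans ((mul_le_mul_of_nonneg_left (ih (shift x) u hu v hv)
      (Real.exp_pos _).le).trans_eq ?_)
    rw [← Real.exp_add, birkhoffSum_succ', geometricPotential]
    push_cast
    ring_nf

/-! ### Gap points and end points. -/

/-- The left end of `X` is not interior, so it misses every first-level set; disjointness and
injectivity carry this down to level `w.length + 1`. This supplies gap points at every scale. -/
theorem wordMap_sInf_notMem_limitSet (F : ConformalIFS d) (w : List (Fin (d + 1))) :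
    F.wordMap w (sInf F.X) ∉ F.limitSet := by
  have hp : sInf F.X ∈ F.X := F.isCompact_X.sInf_mem F.isConnected_X.nonempty
  have hpi : sInf F.X ∉ interior F.X := by
    intro h
    obtain ⟨δ, hδ, hb⟩ := Metric.isOpen_iff.1 isOpen_interior _ h
    have h1 : sInf F.X - δ / 2 ∈ F.X := interior_subset (hb (by
      simp [abs_of_pos hδ, hδ]))
    linarith [csInf_le F.isCompact_X.bddBelow h1]
  have key : ∀ w v : List (Fin (d + 1)), v.length = w.length + 1 →
      F.wordMap w (sInf F.X) ∉ F.wordMap v '' F.X := by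
    intro w
    induction w with
    | nil =>
      rintro (_ | ⟨b, v⟩) hv ⟨u, hu, h⟩
      · simp at hv
      · change F.f b (F.wordMap v u) = sInf F.X at h
        exact hpi (h ▸ F.mapsTo_interior b ((F.continuousOn_mapsTo_wordMap v).2 hu))
    | cons a w ih =>
      rintro (_ | ⟨b, v⟩) hv ⟨u, hu, h⟩
      · simp at hv
      · have hu' := (F.continuousOn_mapsTo_wordMap v).2 hu
        have hp' := (F.continuousOn_mapsTo_wordMap w).2 hp
        change F.f b (F.wordMap v u) = F.f a (F.wordMap w _) at h
        obtain rfl : b = a := by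
          by_contra hab
          exact (F.separated b a hab).le_bot ⟨mem_image_of_mem _ hu', h ▸ mem_image_of_mem _ hp'⟩
        exact ih v (by simpa using hv) ⟨u, hu, F.injOn_f b hu' hp' h⟩
  intro h
  obtain ⟨v, hv⟩ := mem_iUnion.1 (mem_iInter.1 h (w.length + 1))
  exact key w _ (by simp) hv

/-- An eventually constant code is determined by its tail letter, the start of the tail and a finite
prefix. -/
theorem countable_endPoints (F : ConformalIFS d) : F.endPoints.Countable := by
  have h : ∀ (i : Fin (d + 1)) (n : ℕ),
      {x : ℕ → Fin (d + 1) | ∀ k, n ≤ k → x k = i}.Countable := fun i n => by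
    refine (mapsTo_univ (fun (x : ℕ → Fin (d + 1)) (j : Fin n) => x j) _).countable_of_injOn
      (fun x hx y hy hxy => funext fun k => ?_) (to_countable _)
    rcases lt_or_ge k n with hk | hk
    · exact congrFun hxy ⟨k, hk⟩
    · rw [hx k hk, hy k hk]
  refine ((countable_iUnion fun i => countable_iUnion (h i)).image
    fun x => (F.coding x : ℝ)).mono ?_
  rintro ξ ⟨x, rfl, i, -, n, hx⟩
  exact ⟨x, mem_iUnion.2 ⟨i, mem_iUnion.2 ⟨n, hx⟩⟩, rfl⟩

end ConformalIFS

/-! ### Distribution functions of atomless measures. -/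

theorem distFun_eq_cdf (ν : Measure ℝ) [IsProbabilityMeasure ν] :
    distFun ν = ProbabilityTheory.cdf ν :=
  funext fun x => (ProbabilityTheory.cdf_eq_real ν x).symm

theorem continuous_distFun (ν : Measure ℝ) [IsProbabilityMeasure ν] [NullSingletonClass ν] :
    Continuous (distFun ν) := by
  rw [distFun_eq_cdf]
  refine continuous_iff_continuousAt.2 fun x => ?_
  rw [(ProbabilityTheory.cdf ν).mono.continuousAt_iff_leftLim_eq_rightLim,
    StieltjesFunction.rightLim_eq]
  refine ((ProbabilityTheory.cdf ν).mono.leftLim_le le_rfl).antisymm ?_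
  have h := (ProbabilityTheory.cdf ν).measure_singleton x
  rw [ProbabilityTheory.measure_cdf, measure_singleton] at h
  linarith [ENNReal.ofReal_eq_zero.1 h.symm]

theorem distFun_sub_eq (ν : Measure ℝ) [IsProbabilityMeasure ν] [NullSingletonClass ν] {a b : ℝ}
    (hab : a ≤ b) : distFun ν b - distFun ν a = ν.real (Icc a b) := by
  rw [← measureReal_congr (Ioc_ae_eq_Icc (μ := ν) (a := a) (b := b)), distFun_eq_cdf,
    measureReal_def]
  nth_rewrite 3 [← ProbabilityTheory.measure_cdf ν]
  rw [StieltjesFunction.measure_Ioc,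
    ENNReal.toReal_ofReal (sub_nonneg.2 ((ProbabilityTheory.cdf ν).mono hab))]

theorem abs_distFun_sub_eq (ν : Measure ℝ) [IsProbabilityMeasure ν] [NullSingletonClass ν] (a b : ℝ) :
    |distFun ν a - distFun ν b| = ν.real (uIcc a b) := by
  rcases le_total a b with h | h
  · rw [uIcc_of_le h, abs_sub_comm, distFun_sub_eq ν h, abs_of_nonneg measureReal_nonneg]
  · rw [uIcc_of_ge h, distFun_sub_eq ν h, abs_of_nonneg measureReal_nonneg]

/-! ### Gibbs estimates and unbounded quotients. -/

namespace ConformalIFS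

variable {d : ℕ}

theorem exists_pos_le {g : (ℕ → Fin (d + 1)) → ℝ} (hg : Continuous g) (hpos : ∀ x, 0 < g x) :
    ∃ c > 0, ∀ x, c ≤ g x := by
  obtain ⟨x, -, hx⟩ := isCompact_univ.exists_isMinOn univ_nonempty hg.continuousOn
  exact ⟨g x, hpos x, fun y => hx (mem_univ y)⟩

theorem mul_le_birkhoffSum {β : Type*} {T : β → β} {g : β → ℝ} {c : ℝ} (h : ∀ x, c ≤ g x)
    (n : ℕ) (x : β) : n * c ≤ birkhoffSum T g n x := by
  simpa [birkhoffSum] using Finset.card_nsmul_le_sum (Finset.range n) (fun k => g (T^[k] x)) c fun k _ => h _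

theorem mem_cylinder_self (x : ℕ → Fin (d + 1)) (n : ℕ) : x ∈ cylinder fun i : Fin n => x i :=
  fun _ => rfl

/-- The points of the cylinder `[ω]` of the limit set lie in `f_ω(X)`. -/
theorem coding_image_cylinder_subset (F : ConformalIFS d) {n : ℕ} (w : Fin n → Fin (d + 1)) :
    (fun y => (F.coding y : ℝ)) '' cylinder w ⊆ F.wordMap (List.ofFn w) '' F.X := by
  rintro _ ⟨y, hy, rfl⟩
  have h := F.coding_mem_image y n
  rwa [show (fun i : Fin n => y i) = w from funext hy] at h

variable {F : ConformalIFS d} {ψ : F.limitSet → ℝ} {ν : Measure ℝ}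

/-- By compactness `ψ ≤ -c < 0`, so the cylinders around a point have mass at most `C * exp (-n *
c)`. -/
theorem IsGibbs.noAtoms (hν : F.IsGibbs ψ ν) (hψ : Continuous ψ) (hneg : ∀ ξ, ψ ξ < 0) :
    NullSingletonClass ν := by
  obtain ⟨hprob, hsupp, C, hC, h⟩ := hν
  refine ⟨fun ξ => ?_⟩
  by_cases hξ : ξ ∈ F.limitSet
  swap
  · exact measure_mono_null (singleton_subset_iff.2 hξ) hsupp
  obtain ⟨x, hx⟩ := F.surjective_coding ⟨ξ, hξ⟩
  obtain ⟨c, hc, hψc⟩ := exists_pos_le (g := fun y => -ψ (F.coding y))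
    (hψ.comp F.continuous_coding).neg fun y => neg_pos.2 (hneg _)
  have hle : ∀ n : ℕ, ν.real {ξ} ≤ C * Real.exp (-(n * c)) := fun n => by
    have hsub : {ξ} ⊆ (fun y => (F.coding y : ℝ)) '' cylinder fun i : Fin n => x i :=
      singleton_subset_iff.2 ⟨x, mem_cylinder_self x n, by simp [hx]⟩
    refine (measureReal_mono hsub).trans ((h n _ x (mem_cylinder_self x n)).2.trans ?_)
    gcongr
    have h1 := mul_le_birkhoffSum (T := shift) hψc n x
    simp only [birkhoffSum, Finset.sum_neg_distrib] at h1
    simp only [sumAlong, birkhoffSum]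
    linarith
  have hlim : Tendsto (fun n : ℕ => C * Real.exp (-(n * c))) atTop (𝓝 0) := by
    have h1 := Real.tendsto_exp_neg_atTop_nhds_zero.comp
      (tendsto_natCast_atTop_atTop.atTop_mul_const hc)
    simpa using h1.const_mul C
  have h0 : ν.real {ξ} = 0 := le_antisymm (ge_of_tendsto' hlim hle) measureReal_nonneg
  exact (measureReal_eq_zero_iff).1 h0

/-- The difference quotients of order `α` are unbounded at every point of the limit set. -/
theorem IsGibbs.exists_le_quotient (hν : F.IsGibbs ψ ν) (hψ : Continuous ψ) (hneg : ∀ ξ, ψ ξ < 0)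
    {α : ℝ} (hα : 0 < α) (hlow : ∀ x, α * F.geometricPotential x < ψ (F.coding x))
    {ξ : ℝ} (hξ : ξ ∈ F.limitSet) (M : ℝ) {δ : ℝ} (hδ : 0 < δ) :
    ∃ η, η ≠ ξ ∧ |ξ - η| < δ ∧ M ≤ |distFun ν ξ - distFun ν η| / |ξ - η| ^ α := by
  have := hν.noAtoms hψ hneg
  obtain ⟨hprob, -, C, hC, h⟩ := hν
  obtain ⟨x, hx⟩ := F.surjective_coding ⟨ξ, hξ⟩
  have hψx : Continuous fun y => ψ (F.coding y) := hψ.comp F.continuous_coding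
  obtain ⟨c, hc, hχ⟩ := exists_pos_le
    (g := fun y => ψ (F.coding y) - α * F.geometricPotential y)
    (hψx.sub (F.continuous_geometricPotential.const_mul α)) fun y => sub_pos.2 (hlow y)
  obtain ⟨B, hB⟩ : ∃ B, ∀ y, B ≤ ψ (F.coding y) := by
    obtain ⟨x, -, hx⟩ := isCompact_univ.exists_isMinOn univ_nonempty hψx.continuousOn
    exact ⟨_, fun y => hx (mem_univ y)⟩
  -- With this tolerance, distortion costs `m * (c / 2)` after raising to the power `α`, half of the
  -- gain `m * c`.
  obtain ⟨N, hN⟩ := F.exists_abs_wordMap_sub_le (ε := c / (2 * α)) (by positivity)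
  obtain ⟨N', hN'⟩ := F.exists_abs_wordMap_sub_lt hδ
  -- The final lower bound: `N * B` pays for the spare letters, the factor `1 / 2` for choosing one
  -- end of `K`.
  have hlim : Tendsto (fun m : ℕ => C⁻¹ / 2 * Real.exp (N * B + m * (c / 2))) atTop atTop :=
    (Real.tendsto_exp_atTop.comp (tendsto_atTop_add_const_left _ _
      (tendsto_natCast_atTop_atTop.atTop_mul_const (half_pos hc)))).const_mul_atTop (by positivity)
  obtain ⟨m, hm, hMm⟩ := ((eventually_ge_atTop N').and (hlim.eventually_ge_atTop M)).exists
  let w : Fin (m + N) → Fin (d + 1) := fun i => x i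
  set K := F.wordMap (List.ofFn w) '' F.X with hK
  have hKc : IsCompact K := F.isCompact_wordMap_image _
  have hξK : ξ ∈ K := by
    have h1 := F.coding_mem_image x (m + N)
    rwa [hx] at h1
  have hcyl : C⁻¹ * Real.exp (F.sumAlong ψ (m + N) x) ≤ ν.real K :=
    (h _ w x (mem_cylinder_self x _)).1.trans (measureReal_mono (F.coding_image_cylinder_subset w))
  -- The intervals from `ξ` to the two ends cover `K`, so one of them carries half of its mass.
  obtain ⟨η, hηK, hη⟩ : ∃ η ∈ K, ν.real K / 2 ≤ |distFun ν ξ - distFun ν η| := by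
    have hsub : K ⊆ uIcc ξ (sInf K) ∪ uIcc ξ (sSup K) := fun u hu => by
      have h1 := csInf_le hKc.bddBelow hu
      have h2 := le_csSup hKc.bddAbove hu
      rcases le_total u ξ with h3 | h3
      · exact Or.inl (mem_uIcc.2 (Or.inr ⟨h1, h3⟩))
      · exact Or.inr (mem_uIcc.2 (Or.inl ⟨h3, h2⟩))
    have h1 := (measureReal_mono hsub).trans (measureReal_union_le (μ := ν) _ _)
    rw [← abs_distFun_sub_eq, ← abs_distFun_sub_eq] at h1
    by_contra! hcon
    linarith [hcon _ (hKc.sInf_mem ⟨ξ, hξK⟩), hcon _ (hKc.sSup_mem ⟨ξ, hξK⟩)]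
  have hne : η ≠ ξ := by
    rintro rfl
    have : 0 < C⁻¹ * Real.exp (F.sumAlong ψ (m + N) x) := by positivity
    simp only [sub_self, abs_zero] at hη
    linarith
  refine ⟨η, hne, hN' _ (by simp; omega) ξ hξK η hηK, hMm.trans ?_⟩
  have hpos : 0 < |ξ - η| := abs_pos.2 (sub_ne_zero.2 hne.symm)
  rw [le_div_iff₀ (Real.rpow_pos_of_pos hpos α)]
  refine le_trans ?_ hη
  have hr : |ξ - η| ^ α ≤
      Real.exp (α * (birkhoffSum shift F.geometricPotential m x + m * (c / (2 * α)))) := by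
    rw [mul_comm α, Real.exp_mul]
    exact Real.rpow_le_rpow hpos.le (hN m x ξ hξK η hηK) hα.le
  have hS : N * B + m * (c / 2) +
      α * (birkhoffSum shift F.geometricPotential m x + m * (c / (2 * α))) ≤
      F.sumAlong ψ (m + N) x := by
    have h1 := mul_le_birkhoffSum (T := shift) hχ m x
    have h2 := mul_le_birkhoffSum (T := shift) hB N (shift^[m] x)
    simp only [birkhoffSum, Finset.sum_sub_distrib, ← Finset.mul_sum] at h1 h2
    rw [sumAlong, birkhoffSum_add]
    simp only [birkhoffSum]
    have h3 : α * (m * (c / (2 * α))) = m * (c / 2) := by field_simp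
    rw [mul_add, h3]
    linarith
  calc _ ≤ C⁻¹ / 2 * Real.exp (N * B + m * (c / 2)) *
        Real.exp (α * (birkhoffSum shift F.geometricPotential m x + m * (c / (2 * α)))) := by
        gcongr
    _ = C⁻¹ / 2 * Real.exp (N * B + m * (c / 2) +
        α * (birkhoffSum shift F.geometricPotential m x + m * (c / (2 * α)))) := by
        rw [Real.exp_add (N * B + m * (c / 2)), mul_assoc]
    _ ≤ C⁻¹ / 2 * Real.exp (F.sumAlong ψ (m + N) x) := by gcongr
    _ ≤ ν.real K / 2 := by linarith

theorem IsGibbs.eq_top_of_hasHolderDeriv (hν : F.IsGibbs ψ ν) (hψ : Continuous ψ)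
    (hneg : ∀ ξ, ψ ξ < 0) {α : ℝ} (hα : 0 < α)
    (hlow : ∀ x, α * F.geometricPotential x < ψ (F.coding x))
    {ξ : ℝ} (hξ : ξ ∈ F.limitSet) {l : EReal} (hl : HasHolderDeriv α (distFun ν) ξ l) :
    l = ⊤ := by
  by_contra hne
  obtain ⟨M, hlM, -⟩ := EReal.exists_between_coe_real (lt_top_iff_ne_top.2 hne)
  obtain ⟨δ, hδ, hb⟩ := Metric.eventually_nhds_iff.1
    (eventually_nhdsWithin_iff.1 (hl.eventually (gt_mem_nhds hlM)))
  obtain ⟨η, hηξ, hηδ, hM⟩ := hν.exists_le_quotient hψ hneg hα hlow hξ M hδ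
  have h1 := hb (by rwa [dist_comm, Real.dist_eq]) hηξ
  exact absurd (EReal.coe_lt_coe_iff.1 h1) hM.not_gt

/-! ### Gaps and Baire category. -/

/-- Near every point of the limit set there are a point `ζ` of the limit set and a point `η` of a
gap next to `ζ`. -/
theorem IsGibbs.exists_distFun_eq (hν : F.IsGibbs ψ ν) [NullSingletonClass ν] {ξ : ℝ} (hξ : ξ ∈ F.limitSet)
    {δ : ℝ} (hδ : 0 < δ) :
    ∃ ζ ∈ F.limitSet, ∃ η, η ≠ ζ ∧ |ξ - ζ| < δ ∧ |ζ - η| < δ ∧ distFun ν ζ = distFun ν η := by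
  obtain ⟨hprob, hsupp, -⟩ := hν
  obtain ⟨x, hx⟩ := F.surjective_coding ⟨ξ, hξ⟩
  obtain ⟨N, hN⟩ := F.exists_abs_wordMap_sub_lt (half_pos hδ)
  set η := F.wordMap (List.ofFn fun i : Fin N => x i) (sInf F.X) with hη
  have hηL : η ∉ F.limitSet := F.wordMap_sInf_notMem_limitSet _
  have hξη : |ξ - η| < δ / 2 := by
    have h1 := F.coding_mem_image x N
    rw [hx] at h1
    exact hN _ (by simp) _ h1 _
      (mem_image_of_mem _ (F.isCompact_X.sInf_mem F.isConnected_X.nonempty))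
  -- As `ζ` is a nearest limit point to `η`, the segment between them meets the limit set only in
  -- `ζ` and is null.
  obtain ⟨ζ, hζ, hmin⟩ := F.isCompact_limitSet.exists_isMinOn ⟨ξ, hξ⟩
    (f := fun u => |u - η|) (by fun_prop)
  have hmin' : ∀ u ∈ F.limitSet, |ζ - η| ≤ |u - η| := fun u hu => hmin hu
  have hζη := hmin' ξ hξ
  refine ⟨ζ, hζ, η, fun h => hηL (h ▸ hζ), ?_, by linarith, ?_⟩
  · have := abs_sub_le ξ η ζ
    rw [abs_sub_comm η ζ] at this
    linarith
  · have hsub : uIcc ζ η ⊆ {ζ} ∪ F.limitSetᶜ := fun u hu => by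
      by_contra hcon
      simp only [mem_union, mem_singleton_iff, mem_compl_iff, not_or, not_not] at hcon
      have h1 := hmin' u hcon.2
      have h2 : u ≠ η := fun h => hηL (h ▸ hcon.2)
      rcases mem_uIcc.1 hu with ⟨h3, h4⟩ | ⟨h3, h4⟩
      · rw [abs_of_nonpos (by linarith), abs_of_nonpos (by linarith)] at h1
        exact hcon.1 (by linarith)
      · rw [abs_of_nonneg (by linarith), abs_of_nonneg (by linarith)] at h1
        exact hcon.1 (by linarith)
    have h0 : ν (uIcc ζ η) = 0 :=
      measure_mono_null hsub (measure_union_null (measure_singleton ζ) hsupp)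
    have h1 := abs_distFun_sub_eq ν ζ η
    rw [measureReal_def, h0, ENNReal.toReal_zero] at h1
    exact sub_eq_zero.1 (abs_eq_zero.1 h1)

/-- An isolated point would be a whole cylinder, which has positive mass, against the absence of
atoms. -/
theorem IsGibbs.not_isOpen_singleton (hν : F.IsGibbs ψ ν) [NullSingletonClass ν] (ξ : F.limitSet) :
    ¬ IsOpen ({ξ} : Set F.limitSet) := by
  intro hopen
  obtain ⟨hprob, -, C, hC, h⟩ := hν
  obtain ⟨x, rfl⟩ := F.surjective_coding ξ
  obtain ⟨δ, hδ, hb⟩ := Metric.isOpen_iff.1 hopen _ rfl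
  obtain ⟨N, hN⟩ := F.exists_abs_wordMap_sub_lt hδ
  have hsub : (fun y => (F.coding y : ℝ)) '' cylinder (fun i : Fin N => x i) ⊆
      {(F.coding x : ℝ)} := by
    rintro _ ⟨y, hy, rfl⟩
    have h1 := hN _ (by simp) _ (F.coding_image_cylinder_subset _ (mem_image_of_mem _ hy)) _
      (F.coding_mem_image x N)
    exact congrArg Subtype.val (hb (a := F.coding y) h1)
  have h1 := (h N _ x (mem_cylinder_self x N)).1.trans (measureReal_mono hsub)
  rw [measureReal_def, measure_singleton, ENNReal.toReal_zero] at h1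
  have : 0 < C⁻¹ * Real.exp (F.sumAlong ψ N x) := by positivity
  linarith

/-- For a generic point of the limit set, the lower derivative of order `α` is finite. -/
theorem IsGibbs.residual_frequently_quotient_lt (hν : F.IsGibbs ψ ν) [NullSingletonClass ν] {α : ℝ} :
    ∀ᶠ ξ : F.limitSet in residual F.limitSet, ∃ᶠ η in 𝓝[≠] (ξ : ℝ),
      |distFun ν ξ - distFun ν η| / |(ξ : ℝ) - η| ^ α < 1 := by
  have hprob := hν.1
  -- Membership in every `V n` gives witnesses `η → ξ`. Continuity of the distribution function
  -- makes `V n` open, and gaps make it dense.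
  let V : ℕ → Set F.limitSet := fun n => ⋃ η : ℝ,
    {ξ | |(ξ : ℝ) - η| < 1 / ((n : ℝ) + 1) ∧ (ξ : ℝ) ≠ η ∧
      |distFun ν ξ - distFun ν η| / |(ξ : ℝ) - η| ^ α < 1}
  have hVopen : ∀ n, IsOpen (V n) := fun n => isOpen_iUnion fun η => by
    have hF := continuous_distFun ν
    refine isOpen_iff_mem_nhds.2 fun ξ ⟨h1, h2, h3⟩ => ?_
    have hq : ContinuousAt (fun ξ : F.limitSet =>
        |distFun ν ξ - distFun ν η| / |(ξ : ℝ) - η| ^ α) ξ := by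
      have hd : |(ξ : ℝ) - η| ≠ 0 := abs_ne_zero.2 (sub_ne_zero.2 h2)
      refine ContinuousAt.div (by fun_prop) (ContinuousAt.rpow_const (by fun_prop) (Or.inl hd)) ?_
      exact (Real.rpow_pos_of_pos (abs_pos.2 (sub_ne_zero.2 h2)) α).ne'
    have hd : ContinuousAt (fun ξ : F.limitSet => |(ξ : ℝ) - η|) ξ := by fun_prop
    have hv : ContinuousAt (fun ξ : F.limitSet => (ξ : ℝ)) ξ := by fun_prop
    filter_upwards [hd.eventually (gt_mem_nhds h1), hv.eventually_ne h2,
      hq.eventually (gt_mem_nhds h3)] with u a b c using ⟨a, b, c⟩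
  have hVdense : ∀ n, Dense (V n) := fun n => Metric.dense_iff.2 fun ξ r hr => by
    obtain ⟨ζ, hζ, η, hne, h1, h2, h3⟩ := hν.exists_distFun_eq ξ.2
      (lt_min hr (Nat.one_div_pos_of_nat (α := ℝ) (n := n)))
    refine ⟨⟨ζ, hζ⟩, ?_, mem_iUnion.2 ⟨η, h2.trans_le (min_le_right _ _), hne.symm, ?_⟩⟩
    · rw [Metric.mem_ball, dist_comm]
      exact h1.trans_le (min_le_left _ _)
    · simp [h3]
  have hmem := (countable_iInter_mem (l := residual F.limitSet)).2 fun n =>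
    residual_of_dense_open (hVopen n) (hVdense n)
  filter_upwards [hmem] with ξ hξ
  refine frequently_iff.2 fun {s} hs => ?_
  obtain ⟨δ, hδ, hb⟩ := Metric.mem_nhdsWithin_iff.1 hs
  obtain ⟨n, hn⟩ := exists_nat_one_div_lt hδ
  obtain ⟨η, h1, h2, h3⟩ := mem_iUnion.1 (mem_iInter.1 hξ n)
  exact ⟨η, hb ⟨by rw [Metric.mem_ball, dist_comm]; exact h1.trans hn, h2.symm⟩, h3⟩

end ConformalIFS

/-! ### Conclusion. -/

theorem corollary2p3 {d : ℕ} (F : ConformalIFS d) (α : ℝ) (hα : 0 < α)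
    (ψ : F.limitSet → ℝ)
    (hψ_holder : ∃ C r : ℝ≥0, 0 < r ∧ HolderWith C r ψ)
    (hψ_neg : ∀ ξ, ψ ξ < 0)
    (hψ_pressure : F.HasPressure ψ 0)
    (hψ_lower : ∀ x : ℕ → Fin (d + 1), α * F.geometricPotential x < ψ (F.coding x))
    (ν : Measure ℝ) (hν : F.IsGibbs ψ ν) :
    (∀ ξ ∈ F.limitSet \ F.endPoints, ∀ l : EReal,
      HasHolderDeriv α (distFun ν) ξ l → l = ⊤) ∧
    (∀ U : Set ℝ, IsOpen U → (U ∩ F.limitSet).Nonempty →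
      ¬ {ξ | ξ ∈ U ∩ (F.limitSet \ F.endPoints) ∧
        ¬ ∃ l : EReal, HasHolderDeriv α (distFun ν) ξ l}.Countable) := by
  have hψ : Continuous ψ := by
    obtain ⟨C, r, hr, h⟩ := hψ_holder
    exact h.continuous hr
  have htop : ∀ ξ ∈ F.limitSet, ∀ l : EReal, HasHolderDeriv α (distFun ν) ξ l → l = ⊤ :=
    fun ξ hξ l hl => hν.eq_top_of_hasHolderDeriv hψ hψ_neg hα hψ_lower hξ hl
  refine ⟨fun ξ hξ => htop ξ hξ.1, fun U hU hne hcount => ?_⟩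
  have := hν.noAtoms hψ hψ_neg
  have : CompactSpace F.limitSet := isCompact_iff_compactSpace.1 F.isCompact_limitSet
  set T := {ξ | ξ ∈ U ∩ (F.limitSet \ F.endPoints) ∧
    ¬ ∃ l : EReal, HasHolderDeriv α (distFun ν) ξ l} with hT
  -- Were `T` countable, `T ∪ F.endPoints` would be meagre, since singletons are nowhere dense.
  have hres : ∀ᶠ ξ : F.limitSet in residual F.limitSet, (ξ : ℝ) ∉ T ∪ F.endPoints := by
    have hc : ((↑) ⁻¹' (T ∪ F.endPoints) : Set F.limitSet).Countable :=
      (hcount.union F.countable_endPoints).preimage Subtype.val_injective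
    have hmem := (countable_bInter_mem (l := residual F.limitSet) hc (s := fun ξ _ => {ξ}ᶜ)).2
      fun ξ _ => residual_of_dense_open isOpen_compl_singleton
        (dense_compl_singleton_iff_not_open.2 (hν.not_isOpen_singleton ξ))
    filter_upwards [hmem] with ξ hξ hξT
    exact mem_iInter₂.1 hξ ξ hξT rfl
  obtain ⟨ξ₀, hξ₀U, hξ₀⟩ := hne
  obtain ⟨ξ, hξU, hξ, hfreq⟩ := (dense_of_mem_residual
    (hres.and (hν.residual_frequently_quotient_lt (α := α)))).inter_open_nonempty
      ((fun u : F.limitSet => (u : ℝ)) ⁻¹' U) (hU.preimage continuous_subtype_val) ⟨⟨ξ₀, hξ₀⟩, hξ₀U⟩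
  rw [mem_union, not_or] at hξ
  -- The generic `ξ` lies in `T` after all: a limit would be `⊤`, yet quotients below `1` recur near
  -- `ξ`.
  refine hξ.1 ⟨⟨hξU, ξ.2, hξ.2⟩, fun ⟨l, hl⟩ => ?_⟩
  obtain rfl := htop ξ ξ.2 l hl
  obtain ⟨η, h1, h2⟩ := (hfreq.and_eventually (EReal.tendsto_nhds_top_iff_real.1 hl 1)).exists
  exact absurd (EReal.coe_lt_coe_iff.1 h2) h1.not_gt
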